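/- Let $n\ge 0$ and let $N$ be a convex $(n+3)$-gon. A triangulation of $N$ is identified with its set of diagonals (a maximal set of pairwise non-crossing diagonals of $N$). The *$n$-associahedron* $\mathcal{A}_n$ is the partially ordered set, under inclusion, consisting of the empty face (of rank $-1$) and all sets of the form $\{s : s \text{ a triangulation of } N,\ D\subseteq s\}$, where $D$ is a set of diagonals of some triangulation of $N$; such a face has rank $n-|D|$. A *colored triangulation* is a triangulation of $N$ whose diagonals are assigned colors from a fixed $n$-element set $R$ such that distinct diagonals have distinct colors. Two colored triangulations are joined by an edge of color $c\in R$ if one is obtained from the other by flipping the diagonal of color $c$ (replacing it by the other diagonal of the quadrilateral formed by the two triangles containing it), preserving its color and leaving all other colored diagonals unchanged. For $C\subseteq R$ and a colored triangulation $t$, let $(C,t)$ be the set of all colored triangulations that can be joined to $t$ by a path all of whose edges have colors in $C$. The *colorful $n$-associahedron* $\mathcal{A}^c_n$ is the set consisting of the empty face (of rank $-1$) and all the sets $(C,t)$ (of rank $|C|$), partially ordered by inclusion. The symmetric group $S_n$ on $R$ acts on $\mathcal{A}^c_n$ by automorphisms through permutation of the colors, $\sigma((C,t))=(\sigma(C),t_\sigma)$,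 where $t_\sigma$ is obtained from $t$ by replacing each color $c$ by $\sigma(c)$; the subgroup of the automorphism group of $\mathcal{A}^c_n$ arising in this way is again denoted by $S_n$. The quotient $\mathcal{A}^c_n/S_n$ is the set of $S_n$-orbits of faces, where an orbit $x$ is below an orbit $y$ if and only if there are faces $F\in x$ and $G\in y$ with $F\le G$. **Theorem.** For every $n\ge 0$, $$\mathcal{A}^c_n/S_n\;\cong\;\mathcal{A}_n .$$ Moreover, $\mathcal{A}^c_n$ covers $\mathcal{A}_n$: there is an isomorphism $\Phi:\mathcal{A}^c_n/S_n\to\mathcal{A}_n$ whose composition with the projection $\mathcal{A}^c_n\to\mathcal{A}^c_n/S_n$ is a covering, that is, a surjective order-preserving map which preserves the ranks of faces and maps any two adjacent flags of $\mathcal{A}^c_n$ (maximal chains differing in exactly one face) onto two adjacent flags of $\mathcal{A}_n$. -/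

import Mathlib

namespace Assoc

/-! ### Faces of the colorful polytope of an edge colored graph

An edge colored graph with vertex set `V` and color set `R` is given by the family `G : R → SimpleGraph V`
of its color classes: `(G c).Adj v w` says that `v` and `w` are joined by an edge of color `c`. -/

section Colorful

variable {V R : Type*}

/-- The face `(C, v)`: the equivalence class of `v` under `∼_C`, i.e. the set of all vertices which can be
joined to `v` by a path all of whose edges have colors in `C`. -/
def faceSet (G : R → SimpleGraph V) (C : Finset R) (v : V) : Set V :=
  {w | (⨆ c ∈ C, G c).Reachable v w}

/-- The colorful polytope of an edge colored graph. Its faces, identified with their vertex sets and ordered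
by inclusion, are the empty set and the sets `(C, v)`. -/
abbrev ColorfulPolytope (G : R → SimpleGraph V) : Type _ :=
  {F : Set V // F = ∅ ∨ ∃ (C : Finset R) (v : V), F = faceSet G C v}

/-- `F` is a `j`-face: the empty face has rank `-1`, and `(C, v)` has rank `|C|`. -/
def ColorfulPolytope.HasRank {G : R → SimpleGraph V} (F : ColorfulPolytope G) (j : ℤ) : Prop :=
  (F.1 = ∅ ∧ j = -1) ∨ ∃ (C : Finset R) (v : V), F.1 = faceSet G C v ∧ j = C.card

end Colorful

/-! ### Triangulations of a convex polygon and the associahedron -/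

/-- The diagonals of a convex `(n+3)`-gon with vertices `0, 1, …, n+2` in cyclic order: pairs `i < j` of
vertices which are not adjacent on the boundary. -/
abbrev Diagonal (n : ℕ) : Type :=
  {p : Fin (n + 3) × Fin (n + 3) //
    p.1.val + 1 < p.2.val ∧ ¬ (p.1.val = 0 ∧ p.2.val = n + 2)}

/-- Two diagonals of a convex polygon cross (meet in interior points) iff their end vertices interlace. -/
def Crosses {n : ℕ} (d e : Diagonal n) : Prop :=
  (d.1.1 < e.1.1 ∧ e.1.1 < d.1.2 ∧ d.1.2 < e.1.2) ∨
    (e.1.1 < d.1.1 ∧ d.1.1 < e.1.2 ∧ e.1.2 < d.1.2)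

/-- Triangulations of the convex `(n+3)`-gon, given by their sets of diagonals: a set of diagonals cuts
the polygon into triangles iff it is a maximal set of pairwise non-crossing diagonals. -/
abbrev Triangulation (n : ℕ) : Type :=
  {t : Finset (Diagonal n) // (∀ d ∈ t, ∀ e ∈ t, ¬ Crosses d e) ∧
    ∀ d, (∀ e ∈ t, ¬ Crosses d e) → d ∈ t}

/-- For `i < j`, the segment from `i` to `j` is an edge of a triangle of `t`: it is a side of the polygon
or a diagonal of `t`. -/
def Triangulation.HasEdge {n : ℕ} (t : Triangulation n) (i j : Fin (n + 3)) : Prop :=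
  i.val + 1 = j.val ∨ (i.val = 0 ∧ j.val = n + 2) ∨ ∃ d ∈ t.1, d.1 = (i, j)

/-- `t'` is obtained from `t` by flipping the diagonal `d` of `t`, which is replaced by `d'`: there is a
quadrilateral with vertices `a < b < c < e` whose four sides are edges of `t`, whose two diagonals are `d`
and `d'`, and `d` is replaced by `d'`. -/
def IsFlip {n : ℕ} (t t' : Triangulation n) (d d' : Diagonal n) : Prop :=
  d ∈ t.1 ∧
  (∃ a b c e : Fin (n + 3), a < b ∧ b < c ∧ c < e ∧
    t.HasEdge a b ∧ t.HasEdge b c ∧ t.HasEdge c e ∧ t.HasEdge a e ∧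
    ((d.1 = (a, c) ∧ d'.1 = (b, e)) ∨ (d.1 = (b, e) ∧ d'.1 = (a, c)))) ∧
  t'.1 = insert d' (t.1.erase d)

/-- The `n`-associahedron, as a face lattice. Faces are identified with their vertex sets and ordered by
inclusion; they are the empty face, and for every triangulation `t` and every set `D` of diagonals of `t`
the face whose vertices are all triangulations containing `D`. -/
abbrev Associahedron (n : ℕ) : Type :=
  {F : Set (Triangulation n) // F = ∅ ∨
    ∃ (t : Triangulation n) (D : Finset (Diagonal n)), D ⊆ t.1 ∧ F = {s | D ⊆ s.1}}

/-- `F` is a `j`-face: the empty face has rank `-1`, and the face of all triangulations having a given set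
`D` of `n - j` diagonals (of some triangulation) in common has rank `j`. -/
def Associahedron.HasRank {n : ℕ} (F : Associahedron n) (j : ℤ) : Prop :=
  (F.1 = ∅ ∧ j = -1) ∨
    ∃ (t : Triangulation n) (D : Finset (Diagonal n)),
      D ⊆ t.1 ∧ F.1 = {s | D ⊆ s.1} ∧ j = (n : ℤ) - D.card

/-! ### Colored triangulations and the colorful associahedron -/

/-- Colored triangulations: triangulations whose diagonals are assigned colors from the `n`-set `Fin n`
such that distinct diagonals have distinct colors. -/
structure ColoredTriangulation (n : ℕ) where
  /-- the underlying uncolored triangulation -/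
  supp : Triangulation n
  /-- the coloring of its diagonals -/
  color : {d // d ∈ supp.1} → Fin n
  color_injective : Function.Injective color

/-- `t'` is obtained from `t` by flipping the diagonal of color `k`, preserving its color and
leaving all other colored diagonals unchanged. -/
def IsColoredFlip {n : ℕ} (k : Fin n) (t t' : ColoredTriangulation n) : Prop :=
  ∃ (d d' : Diagonal n) (hd : d ∈ t.supp.1) (hd' : d' ∈ t'.supp.1),
    IsFlip t.supp t'.supp d d' ∧ t.color ⟨d, hd⟩ = k ∧ t'.color ⟨d', hd'⟩ = k ∧
    ∀ (e : Diagonal n) (he : e ∈ t.supp.1) (he' : e ∈ t'.supp.1),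
      t.color ⟨e, he⟩ = t'.color ⟨e, he'⟩

theorem HasEdge.of_flip {n : ℕ} {t t' : Triangulation n} {d d' : Diagonal n} {i j : Fin (n + 3)}
    (ht : t'.1 = insert d' (t.1.erase d)) (hij : d.1 ≠ (i, j)) (h : t.HasEdge i j) :
    t'.HasEdge i j := by
  rcases h with h | h | ⟨x, hx, hxe⟩
  · exact Or.inl h
  · exact Or.inr (Or.inl h)
  · refine Or.inr (Or.inr ⟨x, ?_, hxe⟩)
    rw [ht]
    refine Finset.mem_insert_of_mem (Finset.mem_erase.2 ⟨?_, hx⟩)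
    rintro rfl
    exact hij hxe

theorem IsFlip.symm {n : ℕ} {t t' : Triangulation n} {d d' : Diagonal n}
    (h : IsFlip t t' d d') : IsFlip t' t d' d := by
  obtain ⟨hd, ⟨a, b, c, e, hab, hbc, hce, h1, h2, h3, h4, h5⟩, ht⟩ := h
  have hac := hab.trans hbc
  have hbe := hbc.trans hce
  have hcr : Crosses d d' := by
    rcases h5 with ⟨hx, hy⟩ | ⟨hx, hy⟩
    · left; rw [hx, hy]; exact ⟨hab, hbc, hce⟩
    · right; rw [hx, hy]; exact ⟨hab, hbc, hce⟩
  have hd't : d' ∉ t.1 := fun hm => t.2.1 d hd d' hm hcr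
  have hne : ∀ i j : Fin (n + 3), (i, j) ≠ (a, c) → (i, j) ≠ (b, e) → d.1 ≠ (i, j) := by
    intro i j hi hj hd1
    rcases h5 with ⟨hx, -⟩ | ⟨hx, -⟩
    · exact hi (hd1.symm.trans hx)
    · exact hj (hd1.symm.trans hx)
  refine ⟨by rw [ht]; exact Finset.mem_insert_self _ _,
    ⟨a, b, c, e, hab, hbc, hce, ?_, ?_, ?_, ?_, ?_⟩, ?_⟩
  · refine HasEdge.of_flip ht (hne _ _ ?_ ?_) h1 <;> simp [hbc.ne, hab.ne]
  · refine HasEdge.of_flip ht (hne _ _ ?_ ?_) h2 <;> simp [hce.ne, hab.ne']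
  · refine HasEdge.of_flip ht (hne _ _ ?_ ?_) h3 <;> simp [hac.ne', hbc.ne']
  · refine HasEdge.of_flip ht (hne _ _ ?_ ?_) h4 <;> simp [hce.ne', hab.ne]
  · tauto
  · rw [ht, Finset.erase_insert (fun hm => hd't (Finset.mem_of_mem_erase hm)), Finset.insert_erase hd]

theorem IsFlip.ne {n : ℕ} {t t' : Triangulation n} {d d' : Diagonal n}
    (h : IsFlip t t' d d') : t ≠ t' := by
  have h' := h.symm
  obtain ⟨hd, ⟨a, b, c, e, hab, hbc, hce, -, -, -, -, h5⟩, ht⟩ := h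
  rintro rfl
  refine t.2.1 d hd d' h'.1 ?_
  rcases h5 with ⟨hx, hy⟩ | ⟨hx, hy⟩
  · left; rw [hx, hy]; exact ⟨hab, hbc, hce⟩
  · right; rw [hx, hy]; exact ⟨hab, hbc, hce⟩

theorem IsColoredFlip.symm {n : ℕ} {k : Fin n} {t t' : ColoredTriangulation n}
    (h : IsColoredFlip k t t') : IsColoredFlip k t' t := by
  obtain ⟨d, d', hd, hd', hf, h1, h2, h3⟩ := h
  exact ⟨d', d, hd', hd, hf.symm, h2, h1, fun e he he' => (h3 e he' he).symm⟩

/-- The colorful exchange graph: vertices are the colored triangulations, and edges of color `k` join two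
colored triangulations which differ by flipping the diagonal of color `k`. -/
def exchangeGraph (n : ℕ) (k : Fin n) : SimpleGraph (ColoredTriangulation n) where
  Adj := IsColoredFlip k
  symm := ⟨fun _ _ h => h.symm⟩
  loopless := ⟨fun _ ⟨_, _, _, _, hf, _⟩ => hf.ne rfl⟩

/-- The colorful `n`-associahedron: the colorful polytope of the colorful exchange graph. -/
abbrev ColorfulAssociahedron (n : ℕ) : Type :=
  ColorfulPolytope (exchangeGraph n)

/-! ### The color-permuting automorphisms -/

/-- `t_σ`: the colored triangulation obtained from `t` by replacing each color `c` by `σ c`. -/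
def recolor {n : ℕ} (σ : Equiv.Perm (Fin n)) (t : ColoredTriangulation n) :
    ColoredTriangulation n where
  supp := t.supp
  color := fun d => σ (t.color d)
  color_injective := σ.injective.comp t.color_injective

theorem recolor_mul {n : ℕ} (σ τ : Equiv.Perm (Fin n)) (t : ColoredTriangulation n) :
    recolor (σ * τ) t = recolor σ (recolor τ t) := rfl

theorem recolor_one {n : ℕ} (t : ColoredTriangulation n) : recolor 1 t = t := rfl

theorem IsColoredFlip.recolor {n : ℕ} (σ : Equiv.Perm (Fin n)) {k : Fin n}
    {t t' : ColoredTriangulation n} (h : IsColoredFlip k t t') :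
    IsColoredFlip (σ k) (recolor σ t) (recolor σ t') := by
  obtain ⟨d, d', hd, hd', hf, h1, h2, h3⟩ := h
  exact ⟨d, d', hd, hd', hf, congrArg σ h1, congrArg σ h2, fun e he he' => congrArg σ (h3 e he he')⟩

theorem reachable_recolor {n : ℕ} (σ : Equiv.Perm (Fin n)) (C : Finset (Fin n))
    {t s : ColoredTriangulation n} (h : (⨆ c ∈ C, exchangeGraph n c).Reachable t s) :
    (⨆ c ∈ C.map σ.toEmbedding, exchangeGraph n c).Reachable (recolor σ t) (recolor σ s) := by
  refine SimpleGraph.Reachable.map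
    (G := ⨆ c ∈ C, exchangeGraph n c)
    (G' := ⨆ c ∈ C.map σ.toEmbedding, exchangeGraph n c) ⟨recolor σ, ?_⟩ h
  intro a b hab
  simp only [SimpleGraph.iSup_adj] at hab ⊢
  obtain ⟨c, hc, hab⟩ := hab
  exact ⟨σ c, Finset.mem_map_of_mem _ hc, IsColoredFlip.recolor σ hab⟩

/-- `σ (C, t) = (σ(C), t_σ)`, as vertex sets. -/
theorem image_recolor_faceSet {n : ℕ} (σ : Equiv.Perm (Fin n)) (C : Finset (Fin n))
    (t : ColoredTriangulation n) :
    recolor σ '' faceSet (exchangeGraph n) C t =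
      faceSet (exchangeGraph n) (C.map σ.toEmbedding) (recolor σ t) := by
  ext s
  constructor
  · rintro ⟨r, hr, rfl⟩
    exact reachable_recolor σ C hr
  · intro hs
    refine ⟨recolor σ⁻¹ s, ?_, by rw [← recolor_mul, mul_inv_cancel, recolor_one]⟩
    have h := reachable_recolor σ⁻¹ _ hs
    have hC : (C.map σ.toEmbedding).map (σ⁻¹ : Equiv.Perm (Fin n)).toEmbedding = C := by
      ext x
      simp only [Finset.mem_map_equiv]
      exact Iff.of_eq (congrArg (· ∈ C) (σ.symm_apply_apply x))
    rw [hC, ← recolor_mul, inv_mul_cancel, recolor_one] at h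
    exact h

/-- The action of a color permutation on the faces of the colorful associahedron. -/
def recolorFace {n : ℕ} (σ : Equiv.Perm (Fin n)) (F : ColorfulAssociahedron n) :
    ColorfulAssociahedron n :=
  ⟨recolor σ '' F.1, by
    rcases F.2 with h | ⟨C, t, h⟩
    · left; rw [h, Set.image_empty]
    · right; exact ⟨C.map σ.toEmbedding, recolor σ t, by rw [h, image_recolor_faceSet]⟩⟩

theorem recolorFace_mul {n : ℕ} (σ τ : Equiv.Perm (Fin n)) (F : ColorfulAssociahedron n) :
    recolorFace (σ * τ) F = recolorFace σ (recolorFace τ F) :=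
  Subtype.ext (Set.image_comp (recolor σ) (recolor τ) F.1)

theorem recolorFace_one {n : ℕ} (F : ColorfulAssociahedron n) : recolorFace 1 F = F :=
  Subtype.ext (Set.image_id F.1)

theorem recolorFace_mono {n : ℕ} (σ : Equiv.Perm (Fin n)) {F G : ColorfulAssociahedron n}
    (h : F ≤ G) : recolorFace σ F ≤ recolorFace σ G :=
  Set.image_mono (f := recolor σ) (show F.1 ⊆ G.1 from h)

/-- The action of the symmetric group on the colors by automorphisms of the colorful associahedron. -/
def recolorHom (n : ℕ) :
    Equiv.Perm (Fin n) →* (ColorfulAssociahedron n ≃o ColorfulAssociahedron n) where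
  toFun σ :=
    { toFun := recolorFace σ
      invFun := recolorFace σ⁻¹
      left_inv := fun F => by rw [← recolorFace_mul, inv_mul_cancel, recolorFace_one]
      right_inv := fun F => by rw [← recolorFace_mul, mul_inv_cancel, recolorFace_one]
      map_rel_iff' := by
        intro F G
        refine ⟨fun h => ?_, recolorFace_mono σ⟩
        have h' := recolorFace_mono σ⁻¹ h
        simpa only [Equiv.coe_fn_mk, ← recolorFace_mul, inv_mul_cancel, recolorFace_one] using h' }
  map_one' := by
    apply RelIso.ext
    intro F
    exact recolorFace_one F
  map_mul' σ τ := by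
    apply RelIso.ext
    intro F
    exact recolorFace_mul σ τ F

/-- The color-permuting subgroup `S_n` of the automorphism group of the colorful associahedron. -/
def colorSubgroup (n : ℕ) : Subgroup (ColorfulAssociahedron n ≃o ColorfulAssociahedron n) :=
  (recolorHom n).range

/-! ### Quotients and coverings -/

section Quotients

variable {P Q : Type*} [PartialOrder P] [PartialOrder Q]

/-- The quotient of `P` by a group `H` of automorphisms: its faces are the orbits of faces of `P`. -/
def PolytopeQuotient (H : Subgroup (P ≃o P)) : Type _ :=
  MulAction.orbitRel.Quotient H P

/-- The orbit of a face. -/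
def PolytopeQuotient.mk (H : Subgroup (P ≃o P)) (F : P) : PolytopeQuotient H :=
  Quotient.mk (MulAction.orbitRel H P) F

/-- Incidence in the quotient: one orbit is below another iff they can be represented as the orbits of two
faces of `P`, the first of which is below the second. -/
instance PolytopeQuotient.instLE (H : Subgroup (P ≃o P)) : LE (PolytopeQuotient H) where
  le x y := ∃ F G : P, PolytopeQuotient.mk H F = x ∧ PolytopeQuotient.mk H G = y ∧ F ≤ G

/-- Two flags (maximal chains) are adjacent if they differ by exactly one face. -/
def AdjacentFlags (Φ Ψ : Flag P) : Prop :=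
  ((Φ : Set P) \ Ψ).ncard = 1 ∧ ((Ψ : Set P) \ Φ).ncard = 1

/-- A covering of ranked posets (`rkP F j` says that the face `F` has rank `j`): a surjective homomorphism
which preserves ranks and maps pairs of adjacent flags to pairs of adjacent flags. -/
structure IsCovering (rkP : P → ℤ → Prop) (rkQ : Q → ℤ → Prop) (π : P → Q) : Prop where
  monotone : Monotone π
  surjective : Function.Surjective π
  rank_preserving : ∀ F j, rkP F j ↔ rkQ (π F) j
  adjacency_preserving : ∀ Φ Ψ : Flag P, AdjacentFlags Φ Ψ →
    ∃ Φ' Ψ' : Flag Q, (Φ' : Set Q) = π '' Φ ∧ (Ψ' : Set Q) = π '' Ψ ∧ AdjacentFlags Φ' Ψ'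

end Quotients

end Assoc

/-!
Forgetting the colors sends the face `(C, t)` onto the set of all triangulations containing the
diagonals of `t` with colors outside of `C`: a flip of an uncolored triangulation lifts to a colored
flip, and any two triangulations with a common set `D` of diagonals are connected by flips of
diagonals outside of `D`, since a missing diagonal `d` can be inserted by flipping diagonals that
cross `d`, lowering the number of crossings each time.

Faces `(C, t)` and `(C', t)` with a common vertex `t` are compared by `C` and `C'`, and so are their
images, because a flip removes any single diagonal of `t`. As two colorings of one triangulation
differ by a permutation of the colors, the image of `F` is below that of `G` if and only if `F` is
below some `σ(G)`, so the faces of `𝒜ₙ` are the orbits.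

A flag of `𝒜ᶜₙ` contains a vertex `t`, and the faces of `𝒜ₙ` through the underlying triangulation
lift uniquely to faces through `t`; hence images of flags are flags. Two adjacent flags cannot have
images which coincide: if they share a vertex this is the uniqueness of lifts, and otherwise their
vertices are the two ends of an edge, which are related by a flip.
-/

namespace Assoc

/-! ### Flags and quotients of partially ordered sets -/

section Order

variable {P Q : Type*} [PartialOrder P] [PartialOrder Q]

theorem exists_mem_flag_of_forall_lt [WellFoundedLT P] {ι : Type*} [Nonempty ι] (Φ : Flag P) {F : P}
    {x : ι → P} (hx : ∀ i, F ≤ x i) (h : ∀ G, F < G → ∃ i, x i ≤ G) (hF : F ∈ Φ) :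
    ∃ i, x i ∈ Φ := by
  have mem_of_forall : ∀ i, (∀ G ∈ Φ, F < G → x i ≤ G) → x i ∈ Φ := fun i hi =>
    Flag.mem_iff_forall_le_or_ge.2 fun G hG => by
      obtain hGF | hFG := Φ.le_or_le hG hF
      · exact Or.inr (hGF.trans (hx i))
      · obtain rfl | hlt := hFG.eq_or_lt
        · exact Or.inr (hx i)
        · exact Or.inl (hi G hG hlt)
  by_cases hne : {G | G ∈ Φ ∧ F < G}.Nonempty
  · obtain ⟨G, ⟨hG, hFG⟩, hmin⟩ := wellFounded_lt.has_min _ hne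
    obtain ⟨i, hi⟩ := h G hFG
    refine ⟨i, mem_of_forall i fun G' hG' hFG' => hi.trans ?_⟩
    obtain hle | hle := Φ.le_or_le hG hG'
    · exact hle
    · exact (hle.eq_of_not_lt (hmin G' ⟨hG', hFG'⟩)).ge
  · exact ⟨Classical.arbitrary ι, mem_of_forall _ fun G hG hFG => (hne ⟨G, hG, hFG⟩).elim⟩

theorem injOn_flag_union {π : P → Q} (hπ : StrictMono π) {Φ Ψ : Flag P}
    (h : ∀ F ∈ Φ, F ∉ Ψ → ∀ G ∈ Ψ, G ∉ Φ → π F ≠ π G) : Set.InjOn π (Φ ∪ Ψ : Set P) := by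
  have hchain : ∀ {Θ : Flag P} {F G}, F ∈ Θ → G ∈ Θ → π F = π G → F = G := by
    intro Θ F G hF hG hFG
    obtain hle | hle := Θ.le_or_le hF hG
    · exact hle.eq_of_not_lt fun hlt => (hπ hlt).ne hFG
    · exact (hle.eq_of_not_lt fun hlt => (hπ hlt).ne hFG.symm).symm
  intro F hF G hG hFG
  by_cases hΦ : F ∈ Φ ∧ G ∈ Φ
  · exact hchain hΦ.1 hΦ.2 hFG
  by_cases hΨ : F ∈ Ψ ∧ G ∈ Ψ
  · exact hchain hΨ.1 hΨ.2 hFG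
  obtain hF | hF := hF <;> obtain hG | hG := hG
  · exact absurd ⟨hF, hG⟩ hΦ
  · exact absurd hFG (h F hF (fun hF' => hΨ ⟨hF', hG⟩) G hG fun hG' => hΦ ⟨hF, hG'⟩)
  · exact absurd hFG.symm (h G hG (fun hG' => hΨ ⟨hF, hG'⟩) F hF fun hF' => hΦ ⟨hF', hG⟩)
  · exact absurd ⟨hF, hG⟩ hΨ

namespace AdjacentFlags

variable {Φ Ψ : Flag P}

theorem symm (h : AdjacentFlags Φ Ψ) : AdjacentFlags Ψ Φ := And.symm h

theorem eq_of_notMem (h : AdjacentFlags Φ Ψ) {F G : P} (hF : F ∈ Φ) (hFΨ : F ∉ Ψ) (hG : G ∈ Φ)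
    (hGΨ : G ∉ Ψ) : F = G := by
  obtain ⟨H, hH⟩ := Set.ncard_eq_one.1 h.1
  have hF' : F ∈ ((Φ : Set P) \ Ψ) := ⟨hF, hFΨ⟩
  have hG' : G ∈ ((Φ : Set P) \ Ψ) := ⟨hG, hGΨ⟩
  rw [hH] at hF' hG'
  exact hF'.trans hG'.symm

theorem image {π : P → Q} (h : AdjacentFlags Φ Ψ) (hπ : Set.InjOn π (Φ ∪ Ψ : Set P))
    {Φ' Ψ' : Flag Q} (hΦ : (Φ' : Set Q) = π '' Φ) (hΨ : (Ψ' : Set Q) = π '' Ψ) :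
    AdjacentFlags Φ' Ψ' := by
  have hdiff : ∀ {s t : Set P}, s ⊆ (Φ ∪ Ψ : Set P) → t ⊆ (Φ ∪ Ψ : Set P) →
      (π '' s \ π '' t).ncard = (s \ t).ncard := fun {s t} hs ht => by
    rw [← Set.sdiff_self_inter, ← hπ.image_inter hs ht, ← (hπ.mono hs).image_sdiff,
      ((hπ.mono hs).mono Set.sdiff_subset).ncard_image]
  rw [AdjacentFlags, hΦ, hΨ, hdiff Set.subset_union_left Set.subset_union_right,
    hdiff Set.subset_union_right Set.subset_union_left]
  exact h

end AdjacentFlags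

namespace PolytopeQuotient

variable {H : Subgroup (P ≃o P)}

theorem mk_eq_mk {F G : P} : mk H F = mk H G ↔ ∃ g ∈ H, g G = F :=
  Quotient.eq.trans ⟨fun ⟨g, hg⟩ => ⟨g, g.2, hg⟩, fun ⟨g, hgH, hg⟩ => ⟨⟨g, hgH⟩, hg⟩⟩

theorem map_apply_eq {π : P → Q} (hle : ∀ F G, π F ≤ π G ↔ ∃ g ∈ H, F ≤ g G) {g : P ≃o P}
    (hg : g ∈ H) (F : P) : π (g F) = π F :=
  le_antisymm ((hle _ _).2 ⟨g, hg, le_rfl⟩)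
    ((hle _ _).2 ⟨g⁻¹, H.inv_mem hg, (g.symm_apply_apply F).ge⟩)

/-- The isomorphism of the quotient of `P` by `H` with `Q` induced by a map `π : P → Q` along which
the order of `Q` is the order of the orbits. -/
noncomputable def orderIso {π : P → Q} (hsurj : Function.Surjective π) (hπ : StrictMono π)
    (hle : ∀ F G, π F ≤ π G ↔ ∃ g ∈ H, F ≤ g G) : PolytopeQuotient H ≃o Q where
  toEquiv := Equiv.ofBijective
    (Quotient.lift π fun F G hFG => by
      obtain ⟨g, hg, rfl⟩ := mk_eq_mk.1 (Quotient.sound hFG)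
      exact map_apply_eq hle hg G) <| by
    refine ⟨?_, fun y => (hsurj y).imp' (mk H) fun F hF => hF⟩
    rintro ⟨F⟩ ⟨G⟩ (hFG : π F = π G)
    obtain ⟨g, hg, hF⟩ := (hle F G).1 hFG.le
    refine mk_eq_mk.2 ⟨g, hg, (hF.eq_of_not_lt fun hlt => (hπ hlt).ne ?_).symm⟩
    rw [hFG, map_apply_eq hle hg]
  map_rel_iff' := by
    rintro ⟨F⟩ ⟨G⟩
    refine (hle F G).trans ⟨fun ⟨g, hg, hF⟩ => ⟨F, g G, rfl, mk_eq_mk.2 ⟨g, hg, rfl⟩, hF⟩, ?_⟩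
    rintro ⟨F', G', hF, hG, hFG⟩
    obtain ⟨g, hg, rfl⟩ := mk_eq_mk.1 hF
    obtain ⟨g', hg', rfl⟩ := mk_eq_mk.1 hG
    refine ⟨g⁻¹ * g', H.mul_mem (H.inv_mem hg) hg', ?_⟩
    simpa using (g⁻¹).monotone hFG

end PolytopeQuotient

end Order

/-! ### Colorful polytopes -/

section Colorful

variable {V R : Type*} {G : R → SimpleGraph V} {C C' : Finset R} {v w : V}

theorem mem_faceSet_self : v ∈ faceSet G C v := SimpleGraph.Reachable.refl v

theorem faceSet_eq_of_mem (h : w ∈ faceSet G C v) : faceSet G C w = faceSet G C v :=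
  Set.ext fun _ => ⟨h.trans, h.symm.trans⟩

theorem faceSet_mono (h : C ⊆ C') : faceSet G C v ⊆ faceSet G C' v := fun _ hw =>
  hw.mono (biSup_mono fun _ hc => h hc)

theorem mem_faceSet_of_adj {c : R} (hc : c ∈ C) (h : (G c).Adj v w) : w ∈ faceSet G C v :=
  SimpleGraph.Adj.reachable (by simpa only [SimpleGraph.iSup_adj] using ⟨c, hc, h⟩)

theorem eq_of_mem_faceSet {β : Type*} {f : V → β}
    (hf : ∀ c ∈ C, ∀ v w, (G c).Adj v w → f v = f w) (h : w ∈ faceSet G C v) : f v = f w := by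
  obtain ⟨p⟩ := h
  induction p with
  | nil => rfl
  | cons hadj _ ih =>
    simp only [SimpleGraph.iSup_adj] at hadj
    obtain ⟨c, hc, hadj⟩ := hadj
    exact (hf c hc _ _ hadj).trans ih

theorem faceSet_empty : faceSet G ∅ v = {v} :=
  Set.eq_singleton_iff_unique_mem.2 ⟨mem_faceSet_self, fun _ hw =>
    (eq_of_mem_faceSet (f := id) (fun _ hc => absurd hc (Finset.notMem_empty _)) hw).symm⟩

namespace ColorfulPolytope

/-- The face `(C, v)`. -/
def face (G : R → SimpleGraph V) (C : Finset R) (v : V) : ColorfulPolytope G :=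
  ⟨faceSet G C v, Or.inr ⟨C, v, rfl⟩⟩

instance : OrderBot (ColorfulPolytope G) where
  bot := ⟨∅, Or.inl rfl⟩
  bot_le F := Set.empty_subset F.1

theorem nonempty_of_bot_lt {F : ColorfulPolytope G} (h : ⊥ < F) : F.1.Nonempty :=
  Set.nonempty_iff_ne_empty.2 fun hF => h.ne' (Subtype.ext hF)

theorem face_ne_bot : face G C v ≠ ⊥ := fun h =>
  (congrArg Subtype.val h).subset mem_faceSet_self

theorem exists_eq_face {F : ColorfulPolytope G} (hv : v ∈ F.1) : ∃ C, F = face G C v := by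
  obtain hF | ⟨C, w, hF⟩ := F.2
  · exact absurd (hF ▸ hv) (Set.notMem_empty v)
  · exact ⟨C, Subtype.ext (hF.trans (faceSet_eq_of_mem (hF ▸ hv)).symm)⟩

theorem face_empty_le_iff {F : ColorfulPolytope G} : face G ∅ v ≤ F ↔ v ∈ F.1 := by
  rw [← Subtype.coe_le_coe]
  exact (Iff.of_eq (congrArg (· ⊆ F.1) faceSet_empty)).trans Set.singleton_subset_iff

theorem mem_of_mem_flag {Φ : Flag (ColorfulPolytope G)} {F : ColorfulPolytope G}
    (hv : face G ∅ v ∈ Φ) (hF : F ∈ Φ) (hne : F ≠ ⊥) : v ∈ F.1 := by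
  obtain hvF | hFv := Φ.le_or_le hv hF
  · exact face_empty_le_iff.1 hvF
  · obtain ⟨w, hw⟩ := nonempty_of_bot_lt hne.bot_lt
    obtain rfl : w = v := faceSet_empty.subset (hFv hw)
    exact hw

variable [Finite V] (Φ : Flag (ColorfulPolytope G))

theorem exists_vertex_mem_flag [Nonempty V] : ∃ v, face G ∅ v ∈ Φ :=
  exists_mem_flag_of_forall_lt Φ (fun _ => bot_le)
    (fun _ hF => (nonempty_of_bot_lt hF).imp fun _ => face_empty_le_iff.2) Φ.bot_mem

theorem exists_edge_mem_flag [Nonempty R] (hv : face G ∅ v ∈ Φ) : ∃ c, face G {c} v ∈ Φ := by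
  refine exists_mem_flag_of_forall_lt Φ (fun c => face_empty_le_iff.2 mem_faceSet_self)
    (fun F hF => ?_) hv
  obtain ⟨C, rfl⟩ := exists_eq_face (face_empty_le_iff.1 hF.le)
  obtain rfl | ⟨c, hc⟩ := C.eq_empty_or_nonempty
  · exact absurd hF (lt_irrefl _)
  · exact ⟨c, faceSet_mono (Finset.singleton_subset_iff.2 hc)⟩

end ColorfulPolytope

end Colorful

/-! ### Triangulations of a polygon -/

section Interlacing

variable {α : Type*} [LinearOrder α]

/-- The chords with end vertices `p` and `q` cross. In contrast to `Crosses`, this also makes sense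
for the sides of the polygon. -/
def Interlace (p q : α × α) : Prop :=
  (p.1 < q.1 ∧ q.1 < p.2 ∧ p.2 < q.2) ∨ (q.1 < p.1 ∧ p.1 < q.2 ∧ q.2 < p.2)

theorem Interlace.symm {p q : α × α} (h : Interlace p q) : Interlace q p := Or.symm h

theorem eq_of_interlace_quad {a b c e : α} {z : α × α} (hab : a < b) (hbc : b < c) (hce : c < e)
    (h₁ : ¬ Interlace z (a, b)) (h₂ : ¬ Interlace z (b, c)) (h₃ : ¬ Interlace z (c, e))
    (h₄ : ¬ Interlace z (a, e)) :
    (Interlace z (a, c) → z = (b, e)) ∧ (Interlace z (b, e) → z = (a, c)) := by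
  obtain ⟨x, y⟩ := z
  simp only [Interlace, Prod.mk.injEq] at *
  constructor <;> rintro (h | h) <;> grind

end Interlacing

variable {n : ℕ}

theorem crosses_iff_interlace {d e : Diagonal n} : Crosses d e ↔ Interlace d.1 e.1 := Iff.rfl

theorem Crosses.symm {d e : Diagonal n} (h : Crosses d e) : Crosses e d := Or.symm h

instance : DecidableRel (Crosses (n := n)) := fun _ _ => inferInstanceAs (Decidable (_ ∨ _))

theorem not_crosses_self (d : Diagonal n) : ¬ Crosses d d := by
  rintro (h | h) <;> exact lt_irrefl _ h.1

namespace Triangulation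

variable {t : Triangulation n}

theorem hasEdge_of_mem {d : Diagonal n} (hd : d ∈ t.1) : t.HasEdge d.1.1 d.1.2 :=
  Or.inr (Or.inr ⟨d, hd, rfl⟩)

theorem mem_of_hasEdge {d : Diagonal n} (h : t.HasEdge d.1.1 d.1.2) : d ∈ t.1 := by
  obtain h | h | ⟨e, he, hed⟩ := h
  · exact absurd h d.2.1.ne
  · exact absurd h d.2.2
  · rwa [← Subtype.ext (a1 := e) (a2 := d) hed]

theorem HasEdge.lt {i j : Fin (n + 3)} (h : t.HasEdge i j) : i < j := by
  obtain h | h | ⟨d, -, hd⟩ := h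
  · omega
  · omega
  · obtain ⟨rfl, rfl⟩ := Prod.ext_iff.1 hd
    have := d.2.1
    omega

theorem HasEdge.not_interlace_of {i j : Fin (n + 3)} (h : t.HasEdge i j)
    {p : Fin (n + 3) × Fin (n + 3)} (hp : ∀ d ∈ t.1, d.1 = (i, j) → ¬ Interlace p d.1) :
    ¬ Interlace p (i, j) := by
  obtain h | h | ⟨d, hd, hdij⟩ := h
  · simp only [Interlace]
    omega
  · simp only [Interlace]
    omega
  · exact hdij ▸ hp d hd hdij

theorem HasEdge.not_interlace {i j k l : Fin (n + 3)} (h : t.HasEdge i j) (h' : t.HasEdge k l) :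
    ¬ Interlace (i, j) (k, l) :=
  h'.not_interlace_of fun e he _ hi =>
    h.not_interlace_of (fun d hd _ => t.2.1 e he d hd) hi.symm

theorem hasEdge_of_forall_not_interlace {i j : Fin (n + 3)} (hij : i < j)
    (h : ∀ k l, t.HasEdge k l → ¬ Interlace (i, j) (k, l)) : t.HasEdge i j := by
  by_cases hside : i.val + 1 = j.val
  · exact Or.inl hside
  by_cases hlong : i.val = 0 ∧ j.val = n + 2
  · exact Or.inr (Or.inl hlong)
  exact hasEdge_of_mem (d := ⟨(i, j), by simp only; omega, hlong⟩)
    (t.2.2 _ fun e he => h _ _ (hasEdge_of_mem he))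

theorem exists_max_neighbor (t : Triangulation n) {i j : Fin (n + 3)} (hij : i.val + 1 < j.val) :
    ∃ k, t.HasEdge i k ∧ k < j ∧ ∀ l, t.HasEdge i l → l < j → l ≤ k := by
  obtain ⟨k, ⟨hik, hkj⟩, hmax⟩ := {k | t.HasEdge i k ∧ k < j}.toFinite.exists_maximal
    ⟨⟨i + 1, by omega⟩, Or.inl rfl, hij⟩
  exact ⟨k, hik, hkj, fun l hil hlj => le_of_not_gt fun hkl => hkl.not_ge (hmax ⟨hil, hlj⟩ hkl.le)⟩

theorem HasEdge.exists_apex_below {i j : Fin (n + 3)} (h : t.HasEdge i j)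
    (hij : i.val + 1 < j.val) : ∃ k, t.HasEdge i k ∧ t.HasEdge k j := by
  obtain ⟨k, hik, hkj, hmax⟩ := t.exists_max_neighbor hij
  refine ⟨k, hik, hasEdge_of_forall_not_interlace hkj fun x y hxy hi => ?_⟩
  have hcross := h.not_interlace hxy
  have hcross' := hik.not_interlace hxy
  have := hik.lt
  obtain rfl | hxi := eq_or_ne x i
  · have := hmax y hxy
    simp only [Interlace] at hi
    omega
  · simp only [Interlace] at hi hcross hcross'
    omega

/-- The apex is found by descending through the triangles above `(i, j)`, starting with any edge
`(a, c)` above it. -/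
theorem HasEdge.exists_apex_of_le {i j a c : Fin (n + 3)} (h : t.HasEdge i j) (hac : t.HasEdge a c)
    (hai : a ≤ i) (hjc : j ≤ c) (hne : a < i ∨ j < c) :
    (∃ a, t.HasEdge a i ∧ t.HasEdge a j) ∨ ∃ c, t.HasEdge i c ∧ t.HasEdge j c := by
  have hij := h.lt
  obtain ⟨k, hak, hkc⟩ := hac.exists_apex_below (by omega)
  have hak' := hak.lt
  have hkc' := hkc.lt
  obtain hki | hki := le_or_gt k i
  · by_cases heq : k = i ∧ c = j
    · obtain ⟨rfl, rfl⟩ := heq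
      exact Or.inl ⟨a, hak, hac⟩
    · exact h.exists_apex_of_le hkc hki hjc (by omega)
  obtain hjk | hjk := le_or_gt j k
  · by_cases heq : a = i ∧ k = j
    · obtain ⟨rfl, rfl⟩ := heq
      exact Or.inr ⟨c, hac, hkc⟩
    · exact h.exists_apex_of_le hak hai hjk (by omega)
  · have h₁ := hak.not_interlace h
    have h₂ := h.not_interlace hkc
    simp only [Interlace] at h₁ h₂
    omega
termination_by c.val - a.val

theorem HasEdge.exists_apex_above {i j : Fin (n + 3)} (h : t.HasEdge i j)
    (hne : ¬ (i.val = 0 ∧ j.val = n + 2)) :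
    (∃ a, t.HasEdge a i ∧ t.HasEdge a j) ∨ ∃ c, t.HasEdge i c ∧ t.HasEdge j c := by
  have hlast : (Fin.last (n + 2)).val = n + 2 := rfl
  exact h.exists_apex_of_le (a := 0) (c := Fin.last (n + 2)) (Or.inr (Or.inl ⟨rfl, rfl⟩))
    (Fin.zero_le i) (Fin.le_last j) (by simp only [Fin.lt_def, Fin.val_zero]; omega)

theorem exists_exchange (t : Triangulation n) {d d' : Diagonal n} (hd : d ∈ t.1)
    (hdd' : Crosses d d')
    (h : ∀ x, (∀ y ∈ t.1.erase d, ¬ Crosses x y) →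
      (Crosses x d → x = d') ∧ (Crosses x d' → x = d)) :
    ∃ t' : Triangulation n, t'.1 = insert d' (t.1.erase d) := by
  have hnew : ∀ x ∈ t.1.erase d, ¬ Crosses x d' := fun x hx hc =>
    Finset.ne_of_mem_erase hx ((h x fun y hy => t.2.1 x (Finset.mem_of_mem_erase hx) y
      (Finset.mem_of_mem_erase hy)).2 hc)
  refine ⟨⟨insert d' (t.1.erase d), ?_, fun x hx => ?_⟩, rfl⟩
  · rintro x hx y hy
    obtain rfl | hx' := Finset.mem_insert.1 hx <;> obtain rfl | hy' := Finset.mem_insert.1 hy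
    · exact not_crosses_self _
    · exact fun hc => hnew y hy' hc.symm
    · exact hnew x hx'
    · exact t.2.1 x (Finset.mem_of_mem_erase hx') y (Finset.mem_of_mem_erase hy')
  · obtain ⟨hxd', hx⟩ := Finset.forall_mem_insert _ _ _ |>.1 hx
    by_cases hc : Crosses x d
    · rw [(h x hx).1 hc]
      exact Finset.mem_insert_self _ _
    · refine Finset.mem_insert_of_mem (Finset.mem_erase.2 ⟨?_, t.2.2 x fun y hy => ?_⟩)
      · rintro rfl
        exact hxd' hdd'
      · obtain rfl | hyd := eq_or_ne y d
        · exact hc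
        · exact hx y (Finset.mem_erase.2 ⟨hyd, hy⟩)

theorem exists_isFlip_of_quad {a b c e : Fin (n + 3)} (hab : t.HasEdge a b) (hbc : t.HasEdge b c)
    (hce : t.HasEdge c e) (hae : t.HasEdge a e) {d d' : Diagonal n} (hd : d ∈ t.1)
    (h : (d.1 = (a, c) ∧ d'.1 = (b, e)) ∨ (d.1 = (b, e) ∧ d'.1 = (a, c))) :
    ∃ t', IsFlip t t' d d' := by
  have hab' := hab.lt
  have hbc' := hbc.lt
  have hce' := hce.lt
  have hdd' : Crosses d d' := by
    simp only [crosses_iff_interlace, Interlace]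
    obtain ⟨hd, hd'⟩ | ⟨hd, hd'⟩ := h <;> simp only [hd, hd'] <;> omega
  suffices hx : ∀ x, (∀ y ∈ t.1.erase d, ¬ Crosses x y) →
      (Crosses x d → x = d') ∧ (Crosses x d' → x = d) by
    obtain ⟨t', ht'⟩ := t.exists_exchange hd hdd' hx
    exact ⟨t', hd, ⟨a, b, c, e, hab', hbc', hce', hab, hbc, hce, hae, h⟩, ht'⟩
  intro x hx
  have hside : ∀ {i j}, t.HasEdge i j → d.1 ≠ (i, j) → ¬ Interlace x.1 (i, j) := fun hij hdij =>
    hij.not_interlace_of fun y hy hyij =>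
      hx y (Finset.mem_erase.2 ⟨fun hyd => hdij (hyd ▸ hyij), hy⟩)
  have hdne : ∀ {i j}, (i, j) ≠ (a, c) → (i, j) ≠ (b, e) → d.1 ≠ (i, j) := by
    rintro i j h₁ h₂ hdij
    obtain h | h := h
    · exact h₁ (hdij.symm.trans h.1)
    · exact h₂ (hdij.symm.trans h.1)
  obtain ⟨hac, hbe⟩ := eq_of_interlace_quad hab' hbc' hce'
    (hside hab (hdne (by simp [hbc'.ne]) (by simp [hab'.ne])))
    (hside hbc (hdne (by simp [hab'.ne']) (by simp [hce'.ne])))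
    (hside hce (hdne (by simp [(hab'.trans hbc').ne']) (by simp [hbc'.ne'])))
    (hside hae (hdne (by simp [hce'.ne']) (by simp [hab'.ne])))
  simp only [crosses_iff_interlace, Subtype.ext_iff]
  obtain ⟨hd, hd'⟩ | ⟨hd, hd'⟩ := h <;> rw [hd, hd']
  · exact ⟨hac, hbe⟩
  · exact ⟨hbe, hac⟩

/-- The segment joining the vertices `i` and `j`, in either order, is an edge of a triangle of
`t`. -/
def Joined (t : Triangulation n) (i j : Fin (n + 3)) : Prop :=
  t.HasEdge i j ∨ t.HasEdge j i

theorem exists_isFlip_of_joined {d : Diagonal n} (hd : d ∈ t.1) {k : Fin (n + 3)}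
    (h₁ : t.Joined d.1.1 k) (h₂ : t.Joined d.1.2 k) :
    ∃ t' d', IsFlip t t' d d' ∧ (d'.1.1 = k ∨ d'.1.2 = k) := by
  have hedge := hasEdge_of_mem hd
  have hquad : ∀ a b c e, t.HasEdge a b → t.HasEdge b c → t.HasEdge c e → t.HasEdge a e →
      (d.1 = (a, c) → (b = k ∨ e = k) →
        ∃ t' d', IsFlip t t' d d' ∧ (d'.1.1 = k ∨ d'.1.2 = k)) ∧
      (d.1 = (b, e) → (a = k ∨ c = k) →
        ∃ t' d', IsFlip t t' d d' ∧ (d'.1.1 = k ∨ d'.1.2 = k)) := by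
    intro a b c e hab hbc hce hae
    have := hab.lt
    have := hbc.lt
    have := hce.lt
    constructor <;> intro hd' hk
    · obtain ⟨t', ht'⟩ := exists_isFlip_of_quad hab hbc hce hae hd
        (d' := ⟨(b, e), by simp only; omega, by simp only; omega⟩) (Or.inl ⟨hd', rfl⟩)
      exact ⟨t', _, ht', hk⟩
    · obtain ⟨t', ht'⟩ := exists_isFlip_of_quad hab hbc hce hae hd
        (d' := ⟨(a, c), by simp only; omega, by simp only; omega⟩) (Or.inr ⟨hd', rfl⟩)
      exact ⟨t', _, ht', hk⟩
  obtain ⟨m, hm₁, hm₂⟩ := hedge.exists_apex_below d.2.1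
  obtain hik | hki := h₁ <;> obtain hjk | hkj := h₂
  · exact (hquad _ _ _ _ hm₁ hm₂ hjk hik).1 rfl (Or.inr rfl)
  · obtain ⟨a, hai, haj⟩ | ⟨c, hic, hjc⟩ := hedge.exists_apex_above d.2.2
    · exact (hquad _ _ _ _ hai hik hkj haj).2 rfl (Or.inr rfl)
    · exact (hquad _ _ _ _ hik hkj hjc hic).1 rfl (Or.inl rfl)
  · have := hedge.lt
    have := hki.lt
    have := hjk.lt
    omega
  · exact (hquad _ _ _ _ hki hm₁ hm₂ hkj).2 rfl (Or.inl rfl)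

theorem exists_isFlip {d : Diagonal n} (hd : d ∈ t.1) : ∃ t' d', IsFlip t t' d d' := by
  obtain ⟨k, hik, hkj⟩ := (hasEdge_of_mem hd).exists_apex_below d.2.1
  obtain ⟨t', d', hf, -⟩ := exists_isFlip_of_joined hd (Or.inl hik) (Or.inr hkj)
  exact ⟨t', d', hf⟩

theorem eq_of_subset {s t : Triangulation n} (h : s.1 ⊆ t.1) : s = t :=
  Subtype.ext (h.antisymm fun d hd => s.2.2 d fun e he => t.2.1 d hd e (h he))

end Triangulation

namespace IsFlip

variable {t t' : Triangulation n} {d d' : Diagonal n}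

theorem notMem (h : IsFlip t t' d d') : d ∉ t'.1 := by
  intro hd
  refine h.ne (Triangulation.eq_of_subset ?_)
  rw [← Finset.insert_erase h.1, Finset.insert_subset_iff, h.2.2]
  exact ⟨h.2.2 ▸ hd, Finset.subset_insert _ _⟩

theorem mem_of_ne (h : IsFlip t t' d d') {e : Diagonal n} (he : e ∈ t.1) (hed : e ≠ d) :
    e ∈ t'.1 :=
  h.2.2 ▸ Finset.mem_insert_of_mem (Finset.mem_erase.2 ⟨hed, he⟩)

theorem card_eq (h : IsFlip t t' d d') : t'.1.card = t.1.card := by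
  have hd' : d' ∉ t.1.erase d := fun hmem => h.symm.notMem (Finset.mem_of_mem_erase hmem)
  rw [h.2.2, Finset.card_insert_of_notMem hd', Finset.card_erase_add_one h.1]

end IsFlip

/-! ### Connectedness under flips -/

/-- `t'` arises from `t` by flipping a diagonal outside of `D`. -/
def FlipStep (D : Finset (Diagonal n)) (t t' : Triangulation n) : Prop :=
  ∃ d d', d ∉ D ∧ IsFlip t t' d d'

theorem FlipStep.mono {D D' : Finset (Diagonal n)} (h : D ⊆ D') {t t' : Triangulation n}
    (hs : FlipStep D' t t') : FlipStep D t t' :=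
  let ⟨d, d', hd, hf⟩ := hs
  ⟨d, d', fun hm => hd (h hm), hf⟩

theorem subset_of_reflTransGen_flipStep {D : Finset (Diagonal n)} {t t' : Triangulation n}
    (h : Relation.ReflTransGen (FlipStep D) t t') (hD : D ⊆ t.1) : D ⊆ t'.1 := by
  induction h with
  | refl => exact hD
  | tail _ hstep ih =>
    obtain ⟨d, d', hd, hf⟩ := hstep
    exact fun x hx => hf.mem_of_ne (ih hx) fun hxd => hd (hxd ▸ hx)

namespace Triangulation

theorem exists_isFlip_crosses (t : Triangulation n) {d : Diagonal n} (hd : d ∉ t.1) :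
    ∃ t' x x', IsFlip t t' x x' ∧ Crosses x d ∧ ¬ Crosses x' d := by
  obtain ⟨u, hpu, huq, hmax⟩ := t.exists_max_neighbor d.2.1
  have hpu' := hpu.lt
  suffices hx : ∃ x ∈ t.1, Crosses x d ∧ t.Joined x.1.1 d.1.1 ∧ t.Joined x.1.2 d.1.1 by
    obtain ⟨x, hxt, hxd, hx₁, hx₂⟩ := hx
    obtain ⟨t', x', hf, hx'⟩ := exists_isFlip_of_joined hxt hx₁ hx₂
    refine ⟨t', x, x', hf, hxd, fun hc => ?_⟩
    simp only [crosses_iff_interlace, Interlace] at hc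
    omega
  obtain ⟨a, hap, hau⟩ | ⟨c, hpc, huc⟩ := hpu.exists_apex_above (by omega)
  · have := hap.lt
    let x : Diagonal n := ⟨(a, u), by simp only; omega, by simp only; omega⟩
    exact ⟨x, mem_of_hasEdge (d := x) hau, Or.inl ⟨hap.lt, hpu', huq⟩, Or.inl hap, Or.inr hpu⟩
  · have huc' := huc.lt
    have hcq : c ≠ d.1.2 := by
      rintro rfl
      exact hd (mem_of_hasEdge hpc)
    have hqc : d.1.2 < c := by
      have := hmax c hpc
      omega
    let x : Diagonal n := ⟨(u, c), by simp only; omega, by simp only; omega⟩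
    exact ⟨x, mem_of_hasEdge (d := x) huc, Or.inr ⟨hpu', huq, hqc⟩, Or.inr hpu, Or.inr hpc⟩

theorem exists_reflTransGen_mem (t : Triangulation n) {d : Diagonal n} {D : Finset (Diagonal n)}
    (hD : ∀ x ∈ D, ¬ Crosses x d) :
    ∃ t', Relation.ReflTransGen (FlipStep D) t t' ∧ d ∈ t'.1 := by
  by_cases hd : d ∈ t.1
  · exact ⟨t, .refl, hd⟩
  obtain ⟨t₁, x, x', hf, hx, hx'⟩ := t.exists_isFlip_crosses hd
  have : (t₁.1.filter (Crosses · d)).card < (t.1.filter (Crosses · d)).card := by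
    rw [hf.2.2, Finset.filter_insert, if_neg hx', Finset.filter_erase]
    exact Finset.card_erase_lt_of_mem (Finset.mem_filter.2 ⟨hf.1, hx⟩)
  obtain ⟨t', hpath, hmem⟩ := t₁.exists_reflTransGen_mem hD
  exact ⟨t', .head ⟨x, x', fun hm => hD x hm hx, hf⟩ hpath, hmem⟩
termination_by (t.1.filter (Crosses · d)).card

theorem reflTransGen_flipStep {D : Finset (Diagonal n)} {t s : Triangulation n} (ht : D ⊆ t.1)
    (hs : D ⊆ s.1) : Relation.ReflTransGen (FlipStep D) t s := by
  by_cases hsD : s.1 ⊆ D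
  · rw [eq_of_subset (hsD.trans ht)]
  obtain ⟨d, hds, hdD⟩ := Finset.not_subset.1 hsD
  obtain ⟨t₁, hpath, hdt₁⟩ := t.exists_reflTransGen_mem (d := d) (D := D)
    fun x hx => s.2.1 x (hs hx) d hds
  have : (s.1 \ insert d D).card < (s.1 \ D).card := by
    rw [Finset.sdiff_insert]
    exact Finset.card_erase_lt_of_mem (Finset.mem_sdiff.2 ⟨hds, hdD⟩)
  exact hpath.trans <| Relation.ReflTransGen.mono
    (fun _ _ => FlipStep.mono (Finset.subset_insert d D)) _ _ <| reflTransGen_flipStep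
    (Finset.insert_subset hdt₁ (subset_of_reflTransGen_flipStep hpath ht))
    (Finset.insert_subset hds hs)
termination_by (s.1 \ D).card

/-- The diagonals at the vertex `0`. -/
def fanDiagonal (k : Fin n) : Diagonal n :=
  ⟨(0, ⟨k + 2, by omega⟩), by simp, by simp; omega⟩

theorem fanDiagonal_injective : Function.Injective (fanDiagonal (n := n)) := by
  intro k l h
  simpa [fanDiagonal, Fin.ext_iff] using h

/-- The triangulation all of whose diagonals end in the vertex `0`. -/
def fan (n : ℕ) : Triangulation n where
  val := Finset.univ.map ⟨fanDiagonal, fanDiagonal_injective⟩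
  property := by
    simp only [Finset.mem_map, Finset.mem_univ, true_and, Function.Embedding.coeFn_mk,
      forall_exists_index, forall_apply_eq_imp_iff]
    refine ⟨fun k l => ?_, fun d hd => ?_⟩
    · rintro (h | h) <;> exact lt_irrefl _ h.1
    -- A diagonal `(i, j)` with `0 < i` crosses the diagonal `(0, i + 1)`.
    have h0 : d.1.1.val = 0 := by
      by_contra h0
      refine hd ⟨d.1.1 - 1, by omega⟩ (Or.inr ?_)
      simp only [fanDiagonal, Fin.lt_def, Fin.val_zero]
      omega
    exact ⟨⟨d.1.2 - 2, by omega⟩, Subtype.ext (Prod.ext (Fin.ext h0.symm) (Fin.ext (by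
      simp only [fanDiagonal]; omega)))⟩

theorem card_eq (t : Triangulation n) : t.1.card = n := by
  have hcard : ∀ s, Relation.ReflTransGen (FlipStep ∅) t s → s.1.card = t.1.card := by
    intro s hs
    induction hs with
    | refl => rfl
    | tail _ hstep ih =>
      obtain ⟨d, d', -, hf⟩ := hstep
      rw [hf.card_eq, ih]
  rw [← hcard (fan n) (reflTransGen_flipStep (Finset.empty_subset _) (Finset.empty_subset _))]
  simp [fan]

theorem setOf_subset_iff {t : Triangulation n} {D D' : Finset (Diagonal n)} (hD : D ⊆ t.1) :
    {s : Triangulation n | D ⊆ s.1} ⊆ {s | D' ⊆ s.1} ↔ D' ⊆ D := by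
  refine ⟨fun h d hd => ?_, fun h s hs => h.trans hs⟩
  by_contra hdD
  obtain ⟨t', d', hf⟩ := exists_isFlip (h hD hd)
  exact hf.notMem (h (fun e he => hf.mem_of_ne (hD he) fun hed => hdD (hed ▸ he)) hd)

end Triangulation

/-! ### Colored triangulations -/

theorem injective_update {α β : Type*} [DecidableEq α] {f : α → β} (hf : Function.Injective f)
    {a : α} {b : β} (hb : ∀ x, f x ≠ b) : Function.Injective (Function.update f a b) := by
  intro x y h
  simp only [Function.update_apply] at h
  split_ifs at h with hx hy hy
  · exact hx.trans hy.symm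
  · exact absurd h.symm (hb y)
  · exact absurd h (hb x)
  · exact hf h

namespace ColoredTriangulation

theorem color_bijective (t : ColoredTriangulation n) : Function.Bijective t.color :=
  (Fintype.bijective_iff_injective_and_card _).2
    ⟨t.color_injective, by rw [Fintype.card_coe, t.supp.card_eq, Fintype.card_fin]⟩

/-- The diagonal of color `c`. -/
noncomputable def diagonal (t : ColoredTriangulation n) (c : Fin n) : Diagonal n :=
  (Equiv.ofBijective t.color t.color_bijective).symm c

variable {t s : ColoredTriangulation n} {C : Finset (Fin n)} {c : Fin n}

theorem diagonal_eq_iff {d : Diagonal n} :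
    t.diagonal c = d ↔ ∃ hd : d ∈ t.supp.1, t.color ⟨d, hd⟩ = c := by
  constructor
  · rintro rfl
    exact ⟨Subtype.prop _, Equiv.ofBijective_apply_symm_apply t.color t.color_bijective c⟩
  · rintro ⟨hd, rfl⟩
    exact congrArg Subtype.val (Equiv.ofBijective_symm_apply_apply t.color t.color_bijective _)

theorem diagonal_mem (t : ColoredTriangulation n) (c : Fin n) : t.diagonal c ∈ t.supp.1 :=
  (diagonal_eq_iff.1 rfl).1

theorem exists_diagonal_eq {d : Diagonal n} (hd : d ∈ t.supp.1) : ∃ c, t.diagonal c = d :=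
  ⟨_, diagonal_eq_iff.2 ⟨hd, rfl⟩⟩

theorem injective_diagonal (t : ColoredTriangulation n) : Function.Injective t.diagonal :=
  Subtype.val_injective.comp (Equiv.injective _)

theorem image_diagonal (t : ColoredTriangulation n) : Finset.univ.image t.diagonal = t.supp.1 := by
  ext d
  simp only [Finset.mem_image, Finset.mem_univ, true_and]
  exact ⟨fun ⟨c, hc⟩ => hc ▸ t.diagonal_mem c, exists_diagonal_eq⟩

theorem ext_diagonal (h : t.diagonal = s.diagonal) : t = s := by
  have hsupp : t.supp = s.supp := Subtype.ext (by rw [← image_diagonal, h, image_diagonal])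
  have hcolor : ∀ d (hd : d ∈ t.supp.1) (hd' : d ∈ s.supp.1),
      t.color ⟨d, hd⟩ = s.color ⟨d, hd'⟩ := fun _ _ hd' =>
    (diagonal_eq_iff.1 (h ▸ diagonal_eq_iff.2 ⟨hd', rfl⟩)).2
  obtain ⟨u, f, hf⟩ := t
  obtain ⟨u', g, hg⟩ := s
  obtain rfl : u = u' := hsupp
  obtain rfl : f = g := funext fun d => hcolor d.1 d.2 d.2
  rfl

instance : Finite (ColoredTriangulation n) :=
  Finite.of_injective diagonal fun _ _ => ext_diagonal

theorem exists_of_diagonals {u : Triangulation n} {f : Fin n → Diagonal n}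
    (hf : Function.Injective f) (hu : ∀ c, f c ∈ u.1) :
    ∃ t : ColoredTriangulation n, t.supp = u ∧ t.diagonal = f := by
  have hbij : Function.Bijective fun c => (⟨f c, hu c⟩ : {d // d ∈ u.1}) :=
    (Fintype.bijective_iff_injective_and_card _).2
      ⟨fun c c' h => hf (congrArg Subtype.val h), by
        rw [Fintype.card_coe, u.card_eq, Fintype.card_fin]⟩
  refine ⟨⟨u, (Equiv.ofBijective _ hbij).symm, Equiv.injective _⟩, rfl, funext fun c => ?_⟩
  exact diagonal_eq_iff.2 ⟨hu c, Equiv.ofBijective_symm_apply_apply _ hbij c⟩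

theorem exists_supp_eq (u : Triangulation n) : ∃ t : ColoredTriangulation n, t.supp = u :=
  ⟨⟨u, u.1.equivFinOfCardEq u.card_eq, Equiv.injective _⟩, rfl⟩

instance : Nonempty (ColoredTriangulation n) :=
  let ⟨t, _⟩ := exists_supp_eq (Triangulation.fan n)
  ⟨t⟩

theorem exists_recolor_eq (h : t.supp = s.supp) : ∃ σ, recolor σ t = s := by
  obtain ⟨u, f, hf⟩ := t
  obtain ⟨u', g, hg⟩ := s
  obtain rfl : u = u' := h
  refine ⟨(Equiv.ofBijective f (color_bijective ⟨u, f, hf⟩)).symm.trans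
    (Equiv.ofBijective g (color_bijective ⟨u, g, hg⟩)), ?_⟩
  simp only [recolor, Equiv.trans_apply, Equiv.ofBijective_symm_apply_apply,
    Equiv.ofBijective_apply]

theorem isColoredFlip_iff {k : Fin n} : IsColoredFlip k t s ↔
    IsFlip t.supp s.supp (t.diagonal k) (s.diagonal k) ∧
      ∀ c ≠ k, s.diagonal c = t.diagonal c := by
  constructor
  · rintro ⟨d, d', hd, hd', hf, hk, hk', hcolor⟩
    obtain rfl : t.diagonal k = d := diagonal_eq_iff.2 ⟨hd, hk⟩
    obtain rfl : s.diagonal k = d' := diagonal_eq_iff.2 ⟨hd', hk'⟩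
    refine ⟨hf, fun c hc => ?_⟩
    obtain ⟨he, hec⟩ := diagonal_eq_iff.1 (rfl : t.diagonal c = _)
    have he' := hf.mem_of_ne he (t.injective_diagonal.ne hc)
    exact diagonal_eq_iff.2 ⟨he', (hcolor _ he he').symm.trans hec⟩
  · rintro ⟨hf, hne⟩
    obtain ⟨hd, hk⟩ := diagonal_eq_iff.1 (rfl : t.diagonal k = _)
    obtain ⟨hd', hk'⟩ := diagonal_eq_iff.1 (rfl : s.diagonal k = _)
    refine ⟨_, _, hd, hd', hf, hk, hk', fun e he he' => ?_⟩
    obtain ⟨c, rfl⟩ := exists_diagonal_eq he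
    have hck : c ≠ k := fun hck => hf.notMem (hck ▸ he')
    rw [(diagonal_eq_iff.1 rfl).2, (diagonal_eq_iff.1 (hne c hck)).2]

theorem exists_isColoredFlip (t : ColoredTriangulation n) {k : Fin n} {u : Triangulation n}
    {d' : Diagonal n} (hf : IsFlip t.supp u (t.diagonal k) d') :
    ∃ s, IsColoredFlip k t s ∧ s.supp = u := by
  have hd' : ∀ c, t.diagonal c ≠ d' := fun c hc => hf.symm.notMem (hc ▸ t.diagonal_mem c)
  obtain ⟨s, rfl, hs⟩ := exists_of_diagonals (u := u) (f := Function.update t.diagonal k d')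
    (injective_update t.injective_diagonal hd') fun c => by
      obtain rfl | hc := eq_or_ne c k
      · rw [Function.update_self]
        exact hf.symm.1
      · rw [Function.update_of_ne hc]
        exact hf.mem_of_ne (t.diagonal_mem c) (t.injective_diagonal.ne hc)
  refine ⟨s, isColoredFlip_iff.2 ⟨?_, fun c hc => ?_⟩, rfl⟩
  · rwa [hs, Function.update_self]
  · rw [hs, Function.update_of_ne hc]

theorem diagonal_eq_of_mem_faceSet (h : s ∈ faceSet (exchangeGraph n) C t) (hc : c ∉ C) :
    s.diagonal c = t.diagonal c :=
  (eq_of_mem_faceSet (f := fun r => r.diagonal c) (fun _ hk _ _ hadj =>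
    ((isColoredFlip_iff.1 hadj).2 c fun hck => hc (hck ▸ hk)).symm) h).symm

theorem eq_of_mem_faceSet_singleton (h : s ∈ faceSet (exchangeGraph n) {c} t)
    (hsupp : s.supp = t.supp) : s = t := by
  have hne : ∀ k ≠ c, s.diagonal k = t.diagonal k := fun k hk =>
    diagonal_eq_of_mem_faceSet h (Finset.notMem_singleton.2 hk)
  obtain ⟨k, hk⟩ := exists_diagonal_eq (hsupp ▸ s.diagonal_mem c)
  obtain rfl : k = c := by
    by_contra hkc
    exact hkc (s.injective_diagonal ((hne k hkc).trans hk))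
  refine ext_diagonal (funext fun j => ?_)
  obtain rfl | hj := eq_or_ne j k
  · exact hk.symm
  · exact hne j hj

/-- The diagonals of `t` with a color outside of `C`, which are common to all vertices of
`(C, t)`. -/
noncomputable def fixedDiagonals (C : Finset (Fin n)) (t : ColoredTriangulation n) :
    Finset (Diagonal n) :=
  Cᶜ.image t.diagonal

theorem fixedDiagonals_subset : fixedDiagonals C t ⊆ t.supp.1 :=
  Finset.image_subset_iff.2 fun c _ => t.diagonal_mem c

theorem card_fixedDiagonals : ((fixedDiagonals C t).card : ℤ) = n - C.card := by
  have hcompl := C.card_add_card_compl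
  rw [Fintype.card_fin] at hcompl
  rw [fixedDiagonals, Finset.card_image_of_injective _ t.injective_diagonal]
  omega

theorem fixedDiagonals_subset_iff {C' : Finset (Fin n)} :
    fixedDiagonals C t ⊆ fixedDiagonals C' t ↔ C' ⊆ C :=
  (Finset.image_subset_image_iff t.injective_diagonal).trans Finset.compl_subset_compl

theorem exists_fixedDiagonals_eq {D : Finset (Diagonal n)} (hD : D ⊆ t.supp.1) :
    ∃ C, fixedDiagonals C t = D := by
  rw [← image_diagonal, Finset.subset_image_iff] at hD
  obtain ⟨C, -, rfl⟩ := hD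
  exact ⟨Cᶜ, by rw [fixedDiagonals, compl_compl]⟩

theorem fixedDiagonals_eq_of_mem (h : s ∈ faceSet (exchangeGraph n) C t) :
    fixedDiagonals C s = fixedDiagonals C t :=
  Finset.image_congr fun _ hc => diagonal_eq_of_mem_faceSet h (Finset.mem_compl.1 hc)

theorem exists_mem_faceSet_of_reflTransGen {u : Triangulation n}
    (h : Relation.ReflTransGen (FlipStep (fixedDiagonals C t)) t.supp u) :
    ∃ s ∈ faceSet (exchangeGraph n) C t, s.supp = u := by
  induction h with
  | refl => exact ⟨t, mem_faceSet_self, rfl⟩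
  | tail _ hstep ih =>
    obtain ⟨s, hs, rfl⟩ := ih
    obtain ⟨d, d', hd, hf⟩ := hstep
    obtain ⟨c, rfl⟩ := exists_diagonal_eq hf.1
    have hc : c ∈ C := by
      by_contra hc
      refine hd (fixedDiagonals_eq_of_mem hs ▸ ?_)
      exact Finset.mem_image_of_mem _ (Finset.mem_compl.2 hc)
    obtain ⟨r, hr, hru⟩ := s.exists_isColoredFlip hf
    exact ⟨r, hs.trans (mem_faceSet_of_adj hc hr), hru⟩

theorem image_supp_faceSet (C : Finset (Fin n)) (t : ColoredTriangulation n) :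
    supp '' faceSet (exchangeGraph n) C t = {u | fixedDiagonals C t ⊆ u.1} := by
  ext u
  constructor
  · rintro ⟨s, hs, rfl⟩
    exact fixedDiagonals_eq_of_mem hs ▸ fixedDiagonals_subset
  · exact fun hu => exists_mem_faceSet_of_reflTransGen
      (Triangulation.reflTransGen_flipStep fixedDiagonals_subset hu)

end ColoredTriangulation

/-! ### The covering -/

open ColorfulPolytope ColoredTriangulation

/-- The map `𝒜ᶜₙ → 𝒜ₙ` forgetting the colors, under which `(C, t)` becomes the face of all
triangulations containing the diagonals of `t` with colors outside of `C`. -/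
def uncolor (F : ColorfulAssociahedron n) : Associahedron n :=
  ⟨supp '' F.1, by
    obtain hF | ⟨C, t, hF⟩ := F.2
    · exact Or.inl (by rw [hF, Set.image_empty])
    · exact Or.inr ⟨t.supp, _, fixedDiagonals_subset, by rw [hF, image_supp_faceSet]⟩⟩

variable {F G : ColorfulAssociahedron n} {t s : ColoredTriangulation n}

theorem uncolor_face (C : Finset (Fin n)) (t : ColoredTriangulation n) :
    (uncolor (face (exchangeGraph n) C t)).1 = {u | fixedDiagonals C t ⊆ u.1} :=
  image_supp_faceSet C t

theorem uncolor_monotone : Monotone (uncolor (n := n)) := fun _ _ h => Set.image_mono h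

theorem uncolor_recolorFace (σ : Equiv.Perm (Fin n)) (F : ColorfulAssociahedron n) :
    uncolor (recolorFace σ F) = uncolor F :=
  Subtype.ext (Set.image_image supp (recolor σ) F.1)

theorem uncolor_face_le_iff {C C' : Finset (Fin n)} :
    uncolor (face (exchangeGraph n) C t) ≤ uncolor (face (exchangeGraph n) C' t) ↔ C ⊆ C' := by
  rw [← Subtype.coe_le_coe, uncolor_face, uncolor_face]
  exact (Triangulation.setOf_subset_iff fixedDiagonals_subset).trans fixedDiagonals_subset_iff

theorem le_of_uncolor_le_of_mem (hF : t ∈ F.1) (hG : t ∈ G.1) (h : uncolor F ≤ uncolor G) :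
    F ≤ G := by
  obtain ⟨C, rfl⟩ := exists_eq_face hF
  obtain ⟨C', rfl⟩ := exists_eq_face hG
  exact faceSet_mono (uncolor_face_le_iff.1 h)

theorem eq_of_uncolor_eq_of_mem (hF : t ∈ F.1) (hG : t ∈ G.1) (h : uncolor F = uncolor G) :
    F = G :=
  (le_of_uncolor_le_of_mem hF hG h.le).antisymm (le_of_uncolor_le_of_mem hG hF h.ge)

theorem uncolor_strictMono : StrictMono (uncolor (n := n)) := by
  refine fun F G hlt => (uncolor_monotone hlt.le).lt_of_ne fun h => hlt.ne ?_
  obtain hF | ⟨t, ht⟩ := F.1.eq_empty_or_nonempty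
  · have hG : supp '' G.1 = ∅ := (congrArg Subtype.val h.symm).trans (Set.image_eq_empty.2 hF)
    exact Subtype.ext (hF.trans (Set.image_eq_empty.1 hG).symm)
  · exact eq_of_uncolor_eq_of_mem ht (hlt.le ht) h

theorem exists_uncolor_eq_of_mem {y : Associahedron n} (ht : t.supp ∈ y.1) :
    ∃ F : ColorfulAssociahedron n, t ∈ F.1 ∧ uncolor F = y := by
  obtain hy | ⟨u, D, -, hy⟩ := y.2
  · exact absurd (hy ▸ ht) (Set.notMem_empty _)
  · obtain ⟨C, hC⟩ := exists_fixedDiagonals_eq (hy ▸ ht : t.supp ∈ {s | D ⊆ s.1})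
    exact ⟨face _ C t, mem_faceSet_self, Subtype.ext (by rw [uncolor_face, hC, hy])⟩

theorem uncolor_surjective : Function.Surjective (uncolor (n := n)) := by
  intro y
  obtain hy | ⟨u, hu⟩ := y.1.eq_empty_or_nonempty
  · exact ⟨⊥, Subtype.ext ((Set.image_empty supp).trans hy.symm)⟩
  · obtain ⟨t, rfl⟩ := exists_supp_eq u
    exact (exists_uncolor_eq_of_mem hu).imp fun _ hF => hF.2

theorem uncolor_le_uncolor_iff :
    uncolor F ≤ uncolor G ↔ ∃ g ∈ colorSubgroup n, F ≤ g G := by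
  constructor
  · intro h
    obtain hF | ⟨t, ht⟩ := F.1.eq_empty_or_nonempty
    · exact ⟨1, one_mem _, hF.trans_subset (Set.empty_subset _)⟩
    obtain ⟨s, hs, hst⟩ := h (Set.mem_image_of_mem supp ht)
    obtain ⟨σ, rfl⟩ := exists_recolor_eq hst
    refine ⟨recolorHom n σ, ⟨σ, rfl⟩, le_of_uncolor_le_of_mem ht (Set.mem_image_of_mem _ hs) ?_⟩
    exact h.trans_eq (uncolor_recolorFace σ G).symm
  · rintro ⟨-, ⟨σ, rfl⟩, h⟩
    exact (uncolor_monotone h).trans_eq (uncolor_recolorFace σ G)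

theorem hasRank_uncolor_iff {j : ℤ} : (uncolor F).HasRank j ↔ F.HasRank j := by
  refine or_congr (and_congr_left' Set.image_eq_empty) ⟨?_, ?_⟩
  · rintro ⟨u, D, hDu, hF, rfl⟩
    obtain ⟨t, ht, rfl⟩ : u ∈ (uncolor F).1 := hF ▸ hDu
    obtain ⟨C, rfl⟩ := exists_fixedDiagonals_eq hDu
    refine ⟨C, t, congrArg Subtype.val (eq_of_uncolor_eq_of_mem ht
      (G := face _ C t) mem_faceSet_self (Subtype.ext (hF.trans (uncolor_face C t).symm))), ?_⟩
    rw [card_fixedDiagonals, sub_sub_cancel]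
  · rintro ⟨C, t, hF, rfl⟩
    refine ⟨t.supp, fixedDiagonals C t, fixedDiagonals_subset, ?_, ?_⟩
    · exact (congrArg (supp '' ·) hF).trans (image_supp_faceSet C t)
    · rw [card_fixedDiagonals, sub_sub_cancel]

section Flags

variable {Φ Ψ : Flag (ColorfulAssociahedron n)}

theorem mem_image_uncolor_of_forall_le_or_le {y : Associahedron n}
    (hy : ∀ F ∈ Φ, uncolor F ≤ y ∨ y ≤ uncolor F) :
    y ∈ uncolor '' (Φ : Set (ColorfulAssociahedron n)) := by
  obtain ⟨t, ht⟩ := exists_vertex_mem_flag Φ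
  by_cases hty : t.supp ∈ y.1
  · obtain ⟨F, htF, rfl⟩ := exists_uncolor_eq_of_mem hty
    refine ⟨F, Flag.mem_iff_forall_le_or_ge.2 fun G hG => ?_, rfl⟩
    obtain rfl | hne := eq_or_ne G ⊥
    · exact Or.inr bot_le
    · have htG := mem_of_mem_flag ht hG hne
      exact (hy G hG).symm.imp (le_of_uncolor_le_of_mem htF htG) (le_of_uncolor_le_of_mem htG htF)
  · have hle : y ≤ uncolor (face _ ∅ t) :=
      (hy _ ht).resolve_left fun hle => hty (hle (Set.mem_image_of_mem supp mem_faceSet_self))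
    refine ⟨⊥, Φ.bot_mem, Subtype.ext ?_⟩
    refine (Set.image_empty supp).trans (Set.eq_empty_of_forall_notMem fun u hu => hty ?_).symm
    obtain ⟨s, hs, rfl⟩ := hle hu
    exact Set.mem_singleton_iff.1 (faceSet_empty.subset hs) ▸ hu

theorem isMaxChain_image_uncolor (Φ : Flag (ColorfulAssociahedron n)) :
    IsMaxChain (· ≤ ·) (uncolor '' (Φ : Set (ColorfulAssociahedron n))) := by
  refine ⟨?_, fun c hc hsub => hsub.antisymm fun y hy => ?_⟩
  · exact uncolor_monotone.isChain_image Φ.chain_le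
  · exact mem_image_uncolor_of_forall_le_or_le fun F hF =>
      hc.total (hsub (Set.mem_image_of_mem uncolor hF)) hy

/-- The edge of `Φ` at `t` also lies in `Ψ` and hence contains `s`, but flips change the underlying
triangulation. -/
theorem eq_of_supp_eq_of_adjacentFlags (h : AdjacentFlags Φ Ψ)
    (ht : face (exchangeGraph n) ∅ t ∈ Φ) (htΨ : face (exchangeGraph n) ∅ t ∉ Ψ)
    (hs : face (exchangeGraph n) ∅ s ∈ Ψ) (hst : s.supp = t.supp) : s = t := by
  obtain hn | hn := isEmpty_or_nonempty (Fin n)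
  · exact ext_diagonal (funext hn.elim)
  obtain ⟨c, hc⟩ := exists_edge_mem_flag Φ ht
  have hcΨ : face (exchangeGraph n) {c} t ∈ Ψ := by
    by_contra hcΨ
    have hle := uncolor_face_le_iff.1 (congrArg uncolor (h.eq_of_notMem hc hcΨ ht htΨ)).le
    exact Finset.notMem_empty c (hle (Finset.mem_singleton_self c))
  exact eq_of_mem_faceSet_singleton (mem_of_mem_flag hs hcΨ face_ne_bot) hst

theorem uncolor_ne_of_adjacentFlags (h : AdjacentFlags Φ Ψ) (hF : F ∈ Φ) (hFΨ : F ∉ Ψ)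
    (hG : G ∈ Ψ) (hGΦ : G ∉ Φ) : uncolor F ≠ uncolor G := by
  intro heq
  have hFG : F ≠ G := fun hFG => hGΦ (hFG ▸ hF)
  have hF0 : F ≠ ⊥ := fun hF0 => hFΨ (hF0 ▸ Ψ.bot_mem)
  have hG0 : G ≠ ⊥ := fun hG0 => hGΦ (hG0 ▸ Φ.bot_mem)
  have hcommon : ∀ r, face (exchangeGraph n) ∅ r ∈ Φ → face (exchangeGraph n) ∅ r ∉ Ψ :=
    fun r hr hr' => hFG (eq_of_uncolor_eq_of_mem (mem_of_mem_flag hr hF hF0)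
      (mem_of_mem_flag hr' hG hG0) heq)
  obtain ⟨t, ht⟩ := exists_vertex_mem_flag Φ
  obtain ⟨s, hs⟩ := exists_vertex_mem_flag Ψ
  have htΨ := hcommon t ht
  have hsΦ := fun hsΦ => hcommon s hsΦ hs
  obtain rfl : face _ ∅ t = F := h.eq_of_notMem ht htΨ hF hFΨ
  obtain rfl : face _ ∅ s = G := h.symm.eq_of_notMem hs hsΦ hG hGΦ
  have hst : s.supp = t.supp := by
    simpa [uncolor, face, faceSet_empty] using heq.symm
  exact hFG (by rw [eq_of_supp_eq_of_adjacentFlags h ht htΨ hs hst])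

end Flags

theorem isCovering_uncolor (n : ℕ) :
    IsCovering ColorfulPolytope.HasRank Associahedron.HasRank (uncolor (n := n)) where
  monotone := uncolor_monotone
  surjective := uncolor_surjective
  rank_preserving _ _ := hasRank_uncolor_iff.symm
  adjacency_preserving Φ Ψ h :=
    ⟨.ofIsMaxChain _ (isMaxChain_image_uncolor Φ), .ofIsMaxChain _ (isMaxChain_image_uncolor Ψ),
      rfl, rfl, h.image (injOn_flag_union uncolor_strictMono fun _ hF hFΨ _ hG hGΦ =>
        uncolor_ne_of_adjacentFlags h hF hFΨ hG hGΦ) rfl rfl⟩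

/-- The isomorphism `𝒜ᶜₙ / Sₙ ≃ 𝒜ₙ` which sends the orbit of `F` to `uncolor F`. -/
noncomputable def quotientOrderIso (n : ℕ) :
    PolytopeQuotient (colorSubgroup n) ≃o Associahedron n :=
  PolytopeQuotient.orderIso uncolor_surjective uncolor_strictMono fun _ _ => uncolor_le_uncolor_iff

end Assoc

theorem theorem4p1 (n : ℕ) :
    ∃ Φ : Assoc.PolytopeQuotient (Assoc.colorSubgroup n) ≃o Assoc.Associahedron n,
      Assoc.IsCovering Assoc.ColorfulPolytope.HasRank Assoc.Associahedron.HasRank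
        (fun F : Assoc.ColorfulAssociahedron n =>
          Φ (Assoc.PolytopeQuotient.mk (Assoc.colorSubgroup n) F)) :=
  ⟨Assoc.quotientOrderIso n, Assoc.isCovering_uncolor n⟩
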